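/- Let $\mathcal S\subseteq\mathbb R^d$ be a Borel set of finite Lebesgue measure, $\mathcal A=\mathbb R^m$, $\gamma\in[0,1)$, and consider the Markov decision process with transition density $T(s'\mid s,a)$ (with respect to Lebesgue measure on $\mathcal S$), reward $R(s,a)$ and initial density $T_0$. For a (stochastic or deterministic) policy $\pi$ let $V^\pi(s)=\mathbb E_\pi[\sum_{t\ge0}\gamma^tR(S_t,A_t)\mid S_0=s]$, $Q^\pi(s,a)=\mathbb E_\pi[\sum_{t\ge0}\gamma^tR(S_t,A_t)\mid S_0=s,A_0=a]$ and $A^\pi=Q^\pi-V^\pi$. Let $\mu_\theta:\mathcal S\to\mathbb R^m$, $\theta\in\mathbb R^n$, be a parametrized deterministic policy, with $m\times n$ Jacobian $\nabla_\theta\mu_\theta(s)$, and for $\sigma>0$ let $\pi_{\theta,\sigma}(\cdot\mid s)=\mathcal N(\mu_\theta(s),\sigma^2I)$. Assume that $T,T_0,R,\mu,\nabla_aT,\nabla_aR,\nabla_\theta\mu$ exist, are continuous in all variables, and are bounded. Put $$\Delta_{\mathrm{DPG}}(s,\mu_\theta)=\nabla_aA^{\mu_\theta}(s,a)\big|_{a=\mu_\theta(s)}\,\nabla_\theta\mu_\theta(s)\in\mathbb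 R^n,$$ $$\Delta_{\mathrm{CAC}}^{\sigma}(s,\mu_\theta)=\int_{\mathcal A}\pi_{\theta,\sigma}(a\mid s)\,A^{\pi_{\theta,\sigma}}(s,a)\,H\big(A^{\pi_{\theta,\sigma}}(s,a)\big)\,\big(\mu_\theta(s)-a\big)\nabla_\theta\mu_\theta(s)\,da\in\mathbb R^n,$$ where $H$ is the Heaviside function ($H(x)=1$ for $x>0$ and $H(x)=0$ otherwise). The CAC algorithm descends along $\Delta^\sigma_{\mathrm{CAC}}$; the corresponding ascent direction, normalized as the stochastic policy gradient is, is $-\sigma^{-2}\Delta^\sigma_{\mathrm{CAC}}$. Then for every state $s\in\mathcal S$ and every $\theta\in\mathbb R^n$: the function $a\mapsto A^{\mu_\theta}(s,a)$ is differentiable at $a=\mu_\theta(s)$, the integral defining $\Delta^\sigma_{\mathrm{CAC}}(s,\mu_\theta)$ converges absolutely for every $\sigma>0$, and there is a vector $g^+\in(0,1]^n$ such that $$\lim_{\sigma\to0^+}\,-\frac1{\sigma^2}\,\Delta^\sigma_{\mathrm{CAC}}(s,\mu_\theta)=g^+\circ\Delta_{\mathrm{DPG}}(s,\mu_\theta),$$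 where $\circ$ is the componentwise (Hadamard) product. In particular each coordinate of the limit has the same sign as that coordinate of $\Delta_{\mathrm{DPG}}(s,\mu_\theta)$, and at most its magnitude. -/

import Mathlib

open MeasureTheory ProbabilityTheory Filter Topology

noncomputable section

/-- The reference measure `ds` on a subset `S` of `ℝ^d`: Lebesgue measure on `S`. -/
def stateVolume {d : ℕ} (S : Set (EuclideanSpace ℝ (Fin d))) : Measure S :=
  Measure.comap (Subtype.val : S → EuclideanSpace ℝ (Fin d)) volume

/-- A continuous (discounted) Markov decision process with state space a Borel set `S ⊆ ℝ^d`
and action space `ℝ^m`. The transition function and the initial distribution are given by their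
densities with respect to Lebesgue measure on `S`: `T s a s'` is the density at `s'` of the next
state when action `a` is played in state `s`. -/
structure MDP (d m : ℕ) where
  S : Set (EuclideanSpace ℝ (Fin d))
  measurableSet_S : MeasurableSet S
  T : S → EuclideanSpace ℝ (Fin m) → S → ℝ
  T_nonneg : ∀ s a s', 0 ≤ T s a s'
  measurable_T : Measurable fun x : (S × EuclideanSpace ℝ (Fin m)) × S => T x.1.1 x.1.2 x.2
  lintegral_T : ∀ s a, ∫⁻ s', ENNReal.ofReal (T s a s') ∂(stateVolume S) = 1
  R : S → EuclideanSpace ℝ (Fin m) → ℝ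
  measurable_R : Measurable fun x : S × EuclideanSpace ℝ (Fin m) => R x.1 x.2
  T₀ : S → ℝ
  T₀_nonneg : ∀ s, 0 ≤ T₀ s
  measurable_T₀ : Measurable T₀
  lintegral_T₀ : ∫⁻ s, ENNReal.ofReal (T₀ s) ∂(stateVolume S) = 1
  γ : ℝ
  γ_nonneg : 0 ≤ γ
  γ_lt_one : γ < 1

namespace MDP

variable {d m n : ℕ} (M : MDP d m)

instance sigmaFinite_stateVolume : SigmaFinite (stateVolume M.S) := by
  refine SigmaFinite.of_map _ (f := Subtype.val) measurable_subtype_coe.aemeasurable ?_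
  rw [stateVolume, map_comap_subtype_coe M.measurableSet_S]
  infer_instance

/-- The transition kernel `T(· | s, a)`. -/
def transition : Kernel (M.S × EuclideanSpace ℝ (Fin m)) M.S :=
  Kernel.withDensity (Kernel.const _ (stateVolume M.S))
    fun x s' => ENNReal.ofReal (M.T x.1 x.2 s')

instance isMarkovKernel_transition : IsMarkovKernel M.transition where
  isProbabilityMeasure x := by
    refine ⟨?_⟩
    have h : Measurable (Function.uncurry
        fun (x : M.S × EuclideanSpace ℝ (Fin m)) (s' : M.S) =>
          ENNReal.ofReal (M.T x.1 x.2 s')) := M.measurable_T.ennreal_ofReal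
    rw [transition, Kernel.withDensity_apply' _ h]
    simpa using M.lintegral_T x.1 x.2

section Policy

/-! A stochastic policy is a Markov kernel `π` from states to actions. -/

variable (π : Kernel M.S (EuclideanSpace ℝ (Fin m))) [IsMarkovKernel π]

/-- One step of the state-action chain: from `(s, a)` draw `s' ∼ T(· | s, a)`,
then `a' ∼ π(· | s')`. -/
def step : Kernel (M.S × EuclideanSpace ℝ (Fin m)) (M.S × EuclideanSpace ℝ (Fin m)) :=
  M.transition.compProd (Kernel.prodMkLeft _ π)

instance isMarkovKernel_step : IsMarkovKernel (M.step π) := by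
  unfold step; infer_instance

/-- The same step, as a kernel from the history up to time `t`. -/
def historyStep (t : ℕ) :
    Kernel ((_ : Finset.Iic t) → M.S × EuclideanSpace ℝ (Fin m))
      (M.S × EuclideanSpace ℝ (Fin m)) :=
  (M.step π).comap (fun h => h ⟨t, Finset.mem_Iic.2 le_rfl⟩) (measurable_pi_apply _)

instance isMarkovKernel_historyStep (t : ℕ) : IsMarkovKernel (M.historyStep π t) := by
  unfold historyStep; infer_instance

/-- The law of the trajectory `((S_t, A_t))_t` when `(S_0, A_0) ∼ ρ` and policy `π` is
followed afterwards. -/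
def law (ρ : Measure (M.S × EuclideanSpace ℝ (Fin m))) [IsProbabilityMeasure ρ] :
    Measure (ℕ → M.S × EuclideanSpace ℝ (Fin m)) :=
  Kernel.trajMeasure (X := fun _ => M.S × EuclideanSpace ℝ (Fin m)) ρ (M.historyStep π)

/-- The discounted return `∑ γ^t R(S_t, A_t)` of a trajectory. -/
def discountedReturn (ω : ℕ → M.S × EuclideanSpace ℝ (Fin m)) : ℝ :=
  ∑' t : ℕ, M.γ ^ t * M.R (ω t).1 (ω t).2

/-- `V^π(s)`: expected return given `S_0 = s`. -/
def V (s : M.S) : ℝ :=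
  ∫ ω, M.discountedReturn ω ∂(M.law π ((Measure.dirac s).prod (π s)))

/-- `Q^π(s, a)`: expected return given `S_0 = s`, `A_0 = a`. -/
def Q (s : M.S) (a : EuclideanSpace ℝ (Fin m)) : ℝ :=
  ∫ ω, M.discountedReturn ω ∂(M.law π (Measure.dirac (s, a)))

/-- The advantage function `A^π(s, a) = Q^π(s, a) - V^π(s)`. -/
def advantage (s : M.S) (a : EuclideanSpace ℝ (Fin m)) : ℝ :=
  M.Q π s a - M.V π s

end Policy

/-- The regularity conditions on the process: `T, T₀, R, ∇_a T, ∇_a R` exist, are continuous in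
all variables and bounded. -/
structure Regular : Prop where
  continuous_T : Continuous fun x : M.S × EuclideanSpace ℝ (Fin m) × M.S => M.T x.1 x.2.1 x.2.2
  bounded_T : ∃ C, ∀ s a s', |M.T s a s'| ≤ C
  differentiable_T : ∀ s s', Differentiable ℝ fun a => M.T s a s'
  continuous_grad_T : Continuous fun x : M.S × EuclideanSpace ℝ (Fin m) × M.S =>
    gradient (fun a => M.T x.1 a x.2.2) x.2.1
  bounded_grad_T : ∃ C, ∀ s a s', ‖gradient (fun a => M.T s a s') a‖ ≤ C
  continuous_R : Continuous fun x : M.S × EuclideanSpace ℝ (Fin m) => M.R x.1 x.2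
  bounded_R : ∃ C, ∀ s a, |M.R s a| ≤ C
  differentiable_R : ∀ s, Differentiable ℝ (M.R s)
  continuous_grad_R : Continuous fun x : M.S × EuclideanSpace ℝ (Fin m) =>
    gradient (M.R x.1) x.2
  bounded_grad_R : ∃ C, ∀ s a, ‖gradient (M.R s) a‖ ≤ C
  continuous_T₀ : Continuous M.T₀
  bounded_T₀ : ∃ C, ∀ s, |M.T₀ s| ≤ C

/-- A parametrized deterministic policy `μ_θ`, `θ ∈ ℝ^n`, with each `μ_θ` measurable. -/
structure ParamPolicy (n : ℕ) where
  act : EuclideanSpace ℝ (Fin n) → M.S → EuclideanSpace ℝ (Fin m)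
  measurable_act : ∀ θ, Measurable (act θ)

namespace ParamPolicy

variable {M} (μ : M.ParamPolicy n)

/-- The regularity conditions on the policy: `μ, ∇_θ μ` exist, are continuous in all variables
and bounded. -/
structure Regular : Prop where
  continuous_act : Continuous fun x : EuclideanSpace ℝ (Fin n) × M.S => μ.act x.1 x.2
  bounded_act : ∃ C, ∀ θ s, ‖μ.act θ s‖ ≤ C
  differentiable_act : ∀ s, Differentiable ℝ fun θ => μ.act θ s
  continuous_fderiv_act : Continuous fun x : EuclideanSpace ℝ (Fin n) × M.S =>
    fderiv ℝ (fun θ => μ.act θ x.2) x.1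
  bounded_fderiv_act : ∃ C, ∀ θ s, ‖fderiv ℝ (fun θ => μ.act θ s) θ‖ ≤ C

/-- `μ_θ` seen as a (degenerate) stochastic policy. -/
def det (θ : EuclideanSpace ℝ (Fin n)) : Kernel M.S (EuclideanSpace ℝ (Fin m)) :=
  Kernel.deterministic (μ.act θ) (μ.measurable_act θ)

instance isMarkovKernel_det (θ : EuclideanSpace ℝ (Fin n)) : IsMarkovKernel (μ.det θ) := by
  unfold det; infer_instance

/-- The Gaussian exploration policy `π_{θ,σ}(· | s) = N(μ_θ(s), σ² I)`. -/
def gaussian (θ : EuclideanSpace ℝ (Fin n)) (σ : ℝ) : Kernel M.S (EuclideanSpace ℝ (Fin m)) where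
  toFun s := multivariateGaussian (μ.act θ s) (σ ^ 2 • (1 : Matrix (Fin m) (Fin m) ℝ))
  measurable' := by
    refine Measure.measurable_of_measurable_coe _ fun B hB => ?_
    have h := μ.measurable_act θ
    have key (L : EuclideanSpace ℝ (Fin m) →L[ℝ] EuclideanSpace ℝ (Fin m)) :
        Measurable fun s => (stdGaussian (EuclideanSpace ℝ (Fin m))).map
          (fun x => μ.act θ s + L x) B := by
      have hf : Measurable fun p : M.S × EuclideanSpace ℝ (Fin m) => μ.act θ p.1 + L p.2 := by
        fun_prop
      convert measurable_measure_prodMk_left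
        (ν := stdGaussian (EuclideanSpace ℝ (Fin m))) (hf hB) using 2 with s
      exact Measure.map_apply (by fun_prop) hB
    exact key _

instance isMarkovKernel_gaussian (θ : EuclideanSpace ℝ (Fin n)) (σ : ℝ) :
    IsMarkovKernel (μ.gaussian θ σ) where
  isProbabilityMeasure s := by
    change IsProbabilityMeasure (multivariateGaussian _ _)
    infer_instance

/-- The Jacobian matrix `∇_θ μ_θ(s)`, with entries `∂ (μ_θ(s))_i / ∂ θ_k`. -/
def jacobian (θ : EuclideanSpace ℝ (Fin n)) (s : M.S) : Matrix (Fin m) (Fin n) ℝ :=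
  Matrix.of fun i k => fderiv ℝ (fun ϑ => μ.act ϑ s) θ (EuclideanSpace.single k 1) i

end ParamPolicy

/-- The Heaviside function. -/
def heaviside (x : ℝ) : ℝ := if 0 < x then 1 else 0

variable {M} in
/-- The DPG direction `Δ_DPG(s, μ_θ) = ∇_a A^μ(s, a)|_{a = μ_θ(s)} ∇_θ μ_θ(s)`. -/
def ParamPolicy.dpg (μ : M.ParamPolicy n) (θ : EuclideanSpace ℝ (Fin n)) (s : M.S) :
    Fin n → ℝ :=
  Matrix.vecMul (gradient (M.advantage (μ.det θ) s) (μ.act θ s)).ofLp (μ.jacobian θ s)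

variable {M} in
/-- The integrand `A^π(s, a) H(A^π(s, a)) (μ_θ(s) - a) ∇_θ μ_θ(s)` of the CAC direction,
where `π = π_{θ,σ}`. -/
def ParamPolicy.cacIntegrand (μ : M.ParamPolicy n) (θ : EuclideanSpace ℝ (Fin n)) (σ : ℝ)
    (s : M.S) (a : EuclideanSpace ℝ (Fin m)) : Fin n → ℝ :=
  (M.advantage (μ.gaussian θ σ) s a * heaviside (M.advantage (μ.gaussian θ σ) s a)) •
    Matrix.vecMul (μ.act θ s - a).ofLp (μ.jacobian θ s)

variable {M} in
/-- The CAC direction `Δ_CAC(s, μ_θ) = ∫ π(a|s) A^π(s, a) H(A^π(s, a)) (μ_θ(s) - a) ∇_θ μ_θ(s) da`,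
`π = π_{θ,σ}`; it is a direction of descent. -/
def ParamPolicy.cac (μ : M.ParamPolicy n) (θ : EuclideanSpace ℝ (Fin n)) (σ : ℝ) (s : M.S) :
    Fin n → ℝ :=
  ∫ a, μ.cacIntegrand θ σ s a ∂(μ.gaussian θ σ s)

end MDP

end

/-!
By the Bellman equation, `Q^π(s, ·)` is Lipschitz with a constant that does not depend on the
policy `π`, and two policies whose value functions are uniformly `ε`-close have action-value
functions whose increments in `a` differ by `O(ε ‖a - b‖)`. Since the Gaussian policy plays at
distance `O(σ)` from `μ_θ(s)` on average, its value function is `O(σ)`-close to that of `μ_θ`.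
Hence, with `π = π_{θ,σ}` and `z` standard Gaussian,
`σ⁻¹ A^π(s, μ_θ(s) + σ z)` tends to `⟨b, z⟩`, where `b = ∇_a A^{μ_θ}(s, μ_θ(s))`, and stays
dominated by a multiple of `1 + ‖z‖`. Substituting `a = μ_θ(s) + σ z`, the rescaled CAC direction
therefore tends to `𝔼[max ⟨b, z⟩ 0 • z] ∇_θ μ_θ(s)`, and this expectation is `b / 2`: by the
symmetry `z ↦ -z` it is half of `𝔼[⟨b, z⟩ z]`, and `z` has identity covariance. So `g⁺ = 1/2` in
every coordinate.
-/

section MarkovChain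

variable {X Y : Type*} [MeasurableSpace X] [MeasurableSpace Y]

lemma abs_integral_le_of_forall_abs_le {ν : Measure X} [IsProbabilityMeasure ν] {f : X → ℝ}
    {C : ℝ} (hC : ∀ x, |f x| ≤ C) : |∫ x, f x ∂ν| ≤ C := by
  simpa using norm_integral_le_of_norm_le_const (μ := ν) (f := f) (ae_of_all _ hC)

lemma integrable_of_forall_abs_le {ν : Measure X} [IsFiniteMeasure ν] {f : X → ℝ}
    (hf : Measurable f) {C : ℝ} (hC : ∀ x, |f x| ≤ C) : Integrable f ν :=
  Integrable.of_bound hf.aestronglyMeasurable C (ae_of_all _ hC)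

lemma integral_measure_comp_of_forall_abs_le {κ : Kernel X Y} [IsMarkovKernel κ]
    {ν : Measure X} [IsFiniteMeasure ν] {f : Y → ℝ} (hf : Measurable f) {C : ℝ}
    (hC : ∀ y, |f y| ≤ C) : ∫ y, f y ∂(κ ∘ₘ ν) = ∫ x, ∫ y, f y ∂(κ x) ∂ν := by
  rw [← Measure.snd_compProd, Measure.snd, integral_map (by fun_prop) hf.aestronglyMeasurable,
    Measure.integral_compProd]
  exact integrable_of_forall_abs_le (hf.comp measurable_snd) fun x => hC x.2

section Discounting

variable {γ C : ℝ}

lemma norm_pow_mul_le (hγ : 0 ≤ γ) {x : ℝ} (hx : |x| ≤ C) (t : ℕ) :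
    ‖γ ^ t * x‖ ≤ γ ^ t * C := by
  rw [norm_mul, Real.norm_of_nonneg (pow_nonneg hγ t)]
  exact mul_le_mul_of_nonneg_left hx (pow_nonneg hγ t)

lemma hasSum_pow_mul_const (hγ : 0 ≤ γ) (hγ' : γ < 1) (C : ℝ) :
    HasSum (fun t : ℕ => γ ^ t * C) (C / (1 - γ)) := by
  rw [div_eq_inv_mul]
  exact (hasSum_geometric_of_lt_one hγ hγ').mul_right C

lemma integral_tsum_pow_mul (hγ : 0 ≤ γ) (hγ' : γ < 1) {ν : Measure X} [IsProbabilityMeasure ν]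
    {f : ℕ → X → ℝ} (hf : ∀ t, Measurable (f t)) (hC : ∀ t x, |f t x| ≤ C) :
    ∫ x, ∑' t, γ ^ t * f t x ∂ν = ∑' t, γ ^ t * ∫ x, f t x ∂ν := by
  have hi (t : ℕ) : Integrable (f t) ν := integrable_of_forall_abs_le (hf t) (hC t)
  simp_rw [← integral_const_mul]
  refine (integral_tsum_of_summable_integral_norm (fun t => (hi t).const_mul _) ?_).symm
  refine (hasSum_pow_mul_const hγ hγ' C).summable.of_nonneg_of_le
    (fun t => integral_nonneg fun x => norm_nonneg _) fun t => ?_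
  calc ∫ x, ‖γ ^ t * f t x‖ ∂ν ≤ ∫ _, γ ^ t * C ∂ν :=
        integral_mono ((hi t).const_mul _).norm (integrable_const _)
          fun x => norm_pow_mul_le hγ (hC t x) t
    _ = γ ^ t * C := by simp

end Discounting

variable (κ : Kernel X X)

section Law

variable [IsMarkovKernel κ]

instance isMarkovKernel_pow (t : ℕ) : IsMarkovKernel (κ ^ t) := by
  induction t with
  | zero => exact inferInstanceAs (IsMarkovKernel Kernel.id)
  | succ t ih =>
    rw [pow_succ']
    exact Kernel.IsMarkovKernel.comp κ (κ ^ t)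

/-- The law of the trajectory `(ω_t)_t` of the time-homogeneous Markov chain with transition
kernel `κ` and initial law `ρ`. -/
noncomputable def markovChainLaw (ρ : Measure X) : Measure (ℕ → X) :=
  Kernel.trajMeasure (X := fun _ => X) ρ fun t =>
    κ.comap (fun h => h ⟨t, Finset.mem_Iic.2 le_rfl⟩) (measurable_pi_apply _)

variable (ρ : Measure X)

lemma map_eval_zero_markovChainLaw : (markovChainLaw κ ρ).map (fun ω => ω 0) = ρ := by
  have eval_zero : (fun ω : ℕ → X => ω 0) =
      (fun h : (_ : Finset.Iic 0) → X => h ⟨0, Finset.mem_Iic.2 le_rfl⟩) ∘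
        Preorder.frestrictLe (π := fun _ => X) 0 := rfl
  rw [eval_zero, ← Measure.map_map (by fun_prop) (by fun_prop), markovChainLaw,
    Kernel.trajMeasure, Measure.map_comp _ _ (by fun_prop), Kernel.traj_map_frestrictLe,
    Kernel.partialTraj_self, Measure.id_comp, Measure.map_map (by fun_prop) (by fun_prop)]
  exact Measure.map_id

variable [IsProbabilityMeasure ρ]

instance isProbabilityMeasure_markovChainLaw : IsProbabilityMeasure (markovChainLaw κ ρ) := by
  unfold markovChainLaw; infer_instance

lemma map_eval_succ_markovChainLaw (t : ℕ) :
    (markovChainLaw κ ρ).map (fun ω => ω (t + 1)) =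
      κ ∘ₘ (markovChainLaw κ ρ).map (fun ω => ω t) := by
  let lastState (h : (_ : Finset.Iic t) → X) : X := h ⟨t, Finset.mem_Iic.2 le_rfl⟩
  have measurable_lastState : Measurable lastState := measurable_pi_apply _
  have one_step : (markovChainLaw κ ρ).map (fun ω => ω (t + 1)) =
      (κ.comap lastState measurable_lastState) ∘ₘ
        (markovChainLaw κ ρ).map (Preorder.frestrictLe (π := fun _ => X) t) := by
    rw [← Measure.snd_compProd, markovChainLaw,
      Kernel.map_frestrictLe_trajMeasure_compProd_eq_map_trajMeasure (X := fun _ => X),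
      Measure.snd, Measure.map_map (by fun_prop) (by fun_prop)]
    rfl
  rw [one_step, ← Kernel.comp_deterministic_eq_comap, ← Measure.comp_assoc,
    Measure.deterministic_comp_eq_map, Measure.map_map measurable_lastState (by fun_prop)]
  rfl

lemma map_eval_markovChainLaw (t : ℕ) :
    (markovChainLaw κ ρ).map (fun ω => ω t) = (κ ^ t) ∘ₘ ρ := by
  induction t with
  | zero => exact (map_eval_zero_markovChainLaw κ ρ).trans Measure.id_comp.symm
  | succ t ih => rw [map_eval_succ_markovChainLaw, ih, Measure.comp_assoc, pow_succ']; rfl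

end Law

/-- The expected discounted sum `∑ γ^t 𝔼[f(ω_t)]` of `f` along the Markov chain with transition
kernel `κ` started at `x`. It is only meaningful when the series converges, for instance for
bounded `f` and `0 ≤ γ < 1`. -/
noncomputable def discountedPotential (γ : ℝ) (f : X → ℝ) (x : X) : ℝ :=
  ∑' t : ℕ, γ ^ t * ∫ y, f y ∂((κ ^ t) x)

variable {γ C : ℝ} {f : X → ℝ}

lemma measurable_discountedPotential (hf : Measurable f) :
    Measurable (discountedPotential κ γ f) :=
  Measurable.tsum fun _ => hf.stronglyMeasurable.integral_kernel.measurable.const_mul _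

variable [IsMarkovKernel κ]

lemma abs_discountedPotential_le (hγ : 0 ≤ γ) (hγ' : γ < 1) (hC : ∀ x, |f x| ≤ C) (x : X) :
    |discountedPotential κ γ f x| ≤ C / (1 - γ) :=
  tsum_of_norm_bounded (hasSum_pow_mul_const hγ hγ' C) fun t =>
    norm_pow_mul_le hγ (abs_integral_le_of_forall_abs_le hC) t

lemma integral_discountedPotential (hγ : 0 ≤ γ) (hγ' : γ < 1) (hf : Measurable f)
    (hC : ∀ x, |f x| ≤ C) (ρ : Measure X) [IsProbabilityMeasure ρ] :
    ∫ x, discountedPotential κ γ f x ∂ρ = ∑' t : ℕ, γ ^ t * ∫ y, f y ∂((κ ^ t) ∘ₘ ρ) := by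
  simp_rw [integral_measure_comp_of_forall_abs_le hf hC]
  exact integral_tsum_pow_mul hγ hγ' (fun t => hf.stronglyMeasurable.integral_kernel.measurable)
    fun t x => abs_integral_le_of_forall_abs_le hC

lemma integral_markovChainLaw_tsum (hγ : 0 ≤ γ) (hγ' : γ < 1) (hf : Measurable f)
    (hC : ∀ x, |f x| ≤ C) (ρ : Measure X) [IsProbabilityMeasure ρ] :
    ∫ ω, ∑' t : ℕ, γ ^ t * f (ω t) ∂(markovChainLaw κ ρ) =
      ∫ x, discountedPotential κ γ f x ∂ρ := by
  have integral_eval (t : ℕ) :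
      ∫ ω, f (ω t) ∂(markovChainLaw κ ρ) = ∫ y, f y ∂((κ ^ t) ∘ₘ ρ) := by
    rw [← map_eval_markovChainLaw, integral_map (measurable_pi_apply t).aemeasurable
      hf.aestronglyMeasurable]
  simp_rw [integral_discountedPotential κ hγ hγ' hf hC, ← integral_eval]
  exact integral_tsum_pow_mul hγ hγ' (fun t => hf.comp (measurable_pi_apply t))
    fun t ω => hC (ω t)

lemma discountedPotential_eq_add_integral (hγ : 0 ≤ γ) (hγ' : γ < 1) (hf : Measurable f)
    (hC : ∀ x, |f x| ≤ C) (x : X) :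
    discountedPotential κ γ f x = f x + γ * ∫ y, discountedPotential κ γ f y ∂(κ x) := by
  have summable : Summable fun t : ℕ => γ ^ t * ∫ y, f y ∂((κ ^ t) x) :=
    (hasSum_pow_mul_const hγ hγ' C).summable.of_norm_bounded fun t =>
      norm_pow_mul_le hγ (abs_integral_le_of_forall_abs_le hC) t
  have comp_eq (t : ℕ) : (κ ^ t) ∘ₘ κ x = (κ ^ (t + 1)) x := by rw [pow_succ]; rfl
  have zeroth_term : ∫ y, f y ∂((κ ^ 0) x) = f x := integral_dirac' f x hf.stronglyMeasurable
  rw [integral_discountedPotential κ hγ hγ' hf hC, discountedPotential,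
    summable.tsum_eq_zero_add, zeroth_term, pow_zero, one_mul, ← tsum_mul_left]
  simp only [comp_eq, pow_succ' γ, mul_assoc]

end MarkovChain

namespace MDP

section Values

variable {d m : ℕ} (M : MDP d m) (π : Kernel M.S (EuclideanSpace ℝ (Fin m))) {C : ℝ}

lemma integral_step {f : M.S × EuclideanSpace ℝ (Fin m) → ℝ} [IsMarkovKernel π]
    (hf : Measurable f) (hC : ∀ x, |f x| ≤ C) (x : M.S × EuclideanSpace ℝ (Fin m)) :
    ∫ y, f y ∂(M.step π x) = ∫ s', ∫ a', f (s', a') ∂(π s') ∂(M.transition x) := by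
  rw [step, integral_compProd (integrable_of_forall_abs_le hf hC)]
  rfl

variable [IsMarkovKernel π]

lemma integral_law_discountedReturn (hC : ∀ s a, |M.R s a| ≤ C)
    (ρ : Measure (M.S × EuclideanSpace ℝ (Fin m))) [IsProbabilityMeasure ρ] :
    ∫ ω, M.discountedReturn ω ∂(M.law π ρ) =
      ∫ x, discountedPotential (M.step π) M.γ (fun x => M.R x.1 x.2) x ∂ρ :=
  integral_markovChainLaw_tsum (M.step π) M.γ_nonneg M.γ_lt_one M.measurable_R
    (fun x => hC x.1 x.2) ρ

lemma Q_eq_discountedPotential (hC : ∀ s a, |M.R s a| ≤ C) (s : M.S)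
    (a : EuclideanSpace ℝ (Fin m)) :
    M.Q π s a = discountedPotential (M.step π) M.γ (fun x => M.R x.1 x.2) (s, a) := by
  rw [Q, M.integral_law_discountedReturn π hC]
  exact integral_dirac' _ _
    (measurable_discountedPotential _ M.measurable_R).stronglyMeasurable

lemma measurable_uncurry_Q (hC : ∀ s a, |M.R s a| ≤ C) :
    Measurable (Function.uncurry (M.Q π)) := by
  have uncurry_Q : Function.uncurry (M.Q π) =
      discountedPotential (M.step π) M.γ fun x => M.R x.1 x.2 :=
    funext fun x => M.Q_eq_discountedPotential π hC x.1 x.2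
  rw [uncurry_Q]
  exact measurable_discountedPotential _ M.measurable_R

lemma measurable_Q (hC : ∀ s a, |M.R s a| ≤ C) (s : M.S) : Measurable (M.Q π s) :=
  (M.measurable_uncurry_Q π hC).of_uncurry_left

lemma abs_Q_le (hC : ∀ s a, |M.R s a| ≤ C) (s : M.S) (a : EuclideanSpace ℝ (Fin m)) :
    |M.Q π s a| ≤ C / (1 - M.γ) := by
  rw [M.Q_eq_discountedPotential π hC]
  exact abs_discountedPotential_le (M.step π) M.γ_nonneg M.γ_lt_one (fun x => hC x.1 x.2) _

lemma integrable_Q (hC : ∀ s a, |M.R s a| ≤ C) (s : M.S)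
    (ν : Measure (EuclideanSpace ℝ (Fin m))) [IsFiniteMeasure ν] : Integrable (M.Q π s) ν :=
  integrable_of_forall_abs_le (M.measurable_Q π hC s) (M.abs_Q_le π hC s)

lemma V_eq_integral_Q (hC : ∀ s a, |M.R s a| ≤ C) (s : M.S) :
    M.V π s = ∫ a, M.Q π s a ∂(π s) := by
  simp_rw [V, M.integral_law_discountedReturn π hC, M.Q_eq_discountedPotential π hC]
  rw [Measure.dirac_prod, integral_map (by fun_prop)
    (measurable_discountedPotential _ M.measurable_R).aestronglyMeasurable]

lemma measurable_V (hC : ∀ s a, |M.R s a| ≤ C) : Measurable (M.V π) := by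
  rw [funext (M.V_eq_integral_Q π hC)]
  exact (M.measurable_uncurry_Q π hC).stronglyMeasurable.integral_kernel_prod_right.measurable

lemma abs_V_le (hC : ∀ s a, |M.R s a| ≤ C) (s : M.S) : |M.V π s| ≤ C / (1 - M.γ) := by
  rw [M.V_eq_integral_Q π hC]
  exact abs_integral_le_of_forall_abs_le (M.abs_Q_le π hC s)

lemma integrable_V (hC : ∀ s a, |M.R s a| ≤ C) (ν : Measure M.S) [IsFiniteMeasure ν] :
    Integrable (M.V π) ν :=
  integrable_of_forall_abs_le (M.measurable_V π hC) (M.abs_V_le π hC)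

theorem Q_eq_reward_add_integral_V (hC : ∀ s a, |M.R s a| ≤ C) (s : M.S)
    (a : EuclideanSpace ℝ (Fin m)) :
    M.Q π s a = M.R s a + M.γ * ∫ s', M.V π s' ∂(M.transition (s, a)) := by
  have integral_V : ∫ s', M.V π s' ∂(M.transition (s, a)) =
      ∫ x, M.Q π x.1 x.2 ∂(M.step π (s, a)) := by
    simp_rw [M.V_eq_integral_Q π hC]
    exact (M.integral_step π (M.measurable_uncurry_Q π hC)
      (fun x => M.abs_Q_le π hC x.1 x.2) (s, a)).symm
  simp_rw [integral_V, M.Q_eq_discountedPotential π hC]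
  exact discountedPotential_eq_add_integral (M.step π) M.γ_nonneg M.γ_lt_one M.measurable_R
    (fun x => hC x.1 x.2) (s, a)

lemma inner_gradient_advantage (s : M.S) (a z : EuclideanSpace ℝ (Fin m)) :
    inner ℝ (gradient (M.advantage π s) a) z = fderiv ℝ (M.Q π s) a z := by
  rw [gradient, InnerProductSpace.toDual_symm_apply]
  exact congrArg (fun L => L z) (fderiv_sub_const (𝕜 := ℝ) (f := M.Q π s) (M.V π s))

end Values

section PolicyComparison

variable {d m : ℕ} (M : MDP d m) (π π' : Kernel M.S (EuclideanSpace ℝ (Fin m)))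
  [IsMarkovKernel π] [IsMarkovKernel π'] {C : ℝ}

lemma Q_sub_Q_eq (hC : ∀ s a, |M.R s a| ≤ C) (s : M.S) (a : EuclideanSpace ℝ (Fin m)) :
    M.Q π s a - M.Q π' s a =
      M.γ * ∫ s', (M.V π s' - M.V π' s') ∂(M.transition (s, a)) := by
  rw [M.Q_eq_reward_add_integral_V π hC, M.Q_eq_reward_add_integral_V π' hC,
    integral_sub (M.integrable_V π hC _) (M.integrable_V π' hC _)]
  ring

lemma abs_Q_sub_Q_le (hC : ∀ s a, |M.R s a| ≤ C) {ε : ℝ}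
    (hε : ∀ s, |M.V π s - M.V π' s| ≤ ε) (s : M.S) (a : EuclideanSpace ℝ (Fin m)) :
    |M.Q π s a - M.Q π' s a| ≤ M.γ * ε := by
  rw [M.Q_sub_Q_eq π π' hC, abs_mul, abs_of_nonneg M.γ_nonneg]
  exact mul_le_mul_of_nonneg_left (abs_integral_le_of_forall_abs_le hε) M.γ_nonneg

lemma abs_V_sub_V_le_of_abs_V_sub_integral_Q_le (hC : ∀ s a, |M.R s a| ≤ C) {ε : ℝ}
    (hε : ∀ s, |M.V π s - ∫ a, M.Q π s a ∂(π' s)| ≤ ε) (s : M.S) :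
    |M.V π s - M.V π' s| ≤ ε / (1 - M.γ) := by
  set D := ⨆ s, |M.V π s - M.V π' s|
  have bddAbove : BddAbove (Set.range fun s => |M.V π s - M.V π' s|) := by
    refine ⟨C / (1 - M.γ) + C / (1 - M.γ), ?_⟩
    rintro _ ⟨s, rfl⟩
    exact (abs_sub _ _).trans (add_le_add (M.abs_V_le π hC s) (M.abs_V_le π' hC s))
  have le_D (s : M.S) : |M.V π s - M.V π' s| ≤ D := le_ciSup bddAbove s
  have one_step (s : M.S) : |∫ a, M.Q π s a ∂(π' s) - M.V π' s| ≤ M.γ * D := by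
    rw [M.V_eq_integral_Q π' hC, ← integral_sub (M.integrable_Q π hC s _)
      (M.integrable_Q π' hC s _)]
    exact abs_integral_le_of_forall_abs_le (M.abs_Q_sub_Q_le π π' hC le_D s)
  have : Nonempty M.S := ⟨s⟩
  have D_le : D ≤ ε + M.γ * D :=
    ciSup_le fun s => (abs_sub_le _ _ _).trans (add_le_add (hε s) (one_step s))
  refine (le_D s).trans ?_
  rw [le_div_iff₀ (sub_pos.2 M.γ_lt_one)]
  linarith

end PolicyComparison

section ActionRegularity

variable {d m : ℕ} (M : MDP d m)

/-- The reward is bounded, and the reward and the transition law are Lipschitz in the action,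
uniformly in the state; for transition laws, with respect to the total variation distance, which
is expressed here by testing against bounded functions. -/
structure LipschitzInAction : Prop where
  bounded_R : ∃ C, ∀ s a, |M.R s a| ≤ C
  lipschitz_R : ∃ K, ∀ s, LipschitzWith K (M.R s)
  lipschitz_transition : ∃ K : ℝ, ∀ (W : M.S → ℝ) (B : ℝ), Measurable W → (∀ s, |W s| ≤ B) →
    ∀ s a b, |∫ s', W s' ∂(M.transition (s, a)) - ∫ s', W s' ∂(M.transition (s, b))| ≤
      K * B * dist a b

/-- In addition to `LipschitzInAction`, the reward and the expectation of every bounded function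
of the next state are differentiable in the action. This is all that the comparison of the CAC
and DPG directions needs from the process. -/
structure SmoothInAction : Prop extends M.LipschitzInAction where
  differentiable_R : ∀ s, Differentiable ℝ (M.R s)
  differentiable_transition : ∀ (W : M.S → ℝ) (B : ℝ), Measurable W → (∀ s, |W s| ≤ B) →
    ∀ s, Differentiable ℝ fun a => ∫ s', W s' ∂(M.transition (s, a))

namespace LipschitzInAction

variable {M}

lemma exists_lipschitzWith_Q (hM : M.LipschitzInAction) :
    ∃ L, ∀ (π : Kernel M.S (EuclideanSpace ℝ (Fin m))) [IsMarkovKernel π] (s : M.S),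
      LipschitzWith L (M.Q π s) := by
  obtain ⟨C, hC⟩ := hM.bounded_R
  obtain ⟨K, hK⟩ := hM.lipschitz_R
  obtain ⟨K', hK'⟩ := hM.lipschitz_transition
  refine ⟨_, fun π _ s => LipschitzWith.of_dist_le'
    (K := K + M.γ * (K' * (C / (1 - M.γ)))) fun a b => ?_⟩
  calc dist (M.Q π s a) (M.Q π s b)
      = |(M.R s a - M.R s b) + M.γ * (∫ s', M.V π s' ∂(M.transition (s, a)) -
          ∫ s', M.V π s' ∂(M.transition (s, b)))| := by
        rw [Real.dist_eq, M.Q_eq_reward_add_integral_V π hC, M.Q_eq_reward_add_integral_V π hC,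
          add_sub_add_comm, mul_sub]
    _ ≤ K * dist a b + M.γ * (K' * (C / (1 - M.γ)) * dist a b) := by
        refine (abs_add_le _ _).trans (add_le_add ((hK s).dist_le_mul a b) ?_)
        rw [abs_mul, abs_of_nonneg M.γ_nonneg]
        exact mul_le_mul_of_nonneg_left
          (hK' _ _ (M.measurable_V π hC) (M.abs_V_le π hC) s a b) M.γ_nonneg
    _ = (K + M.γ * (K' * (C / (1 - M.γ)))) * dist a b := by ring

lemma exists_abs_Q_increment_sub_le (hM : M.LipschitzInAction) :
    ∃ K, ∀ (π π' : Kernel M.S (EuclideanSpace ℝ (Fin m))) [IsMarkovKernel π] [IsMarkovKernel π']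
      (ε : ℝ), (∀ s, |M.V π s - M.V π' s| ≤ ε) → ∀ s a b,
        |(M.Q π s a - M.Q π s b) - (M.Q π' s a - M.Q π' s b)| ≤ K * ε * dist a b := by
  obtain ⟨C, hC⟩ := hM.bounded_R
  obtain ⟨K, hK⟩ := hM.lipschitz_transition
  refine ⟨M.γ * K, fun π π' _ _ ε hε s a b => ?_⟩
  have transition_bound := hK _ ε ((M.measurable_V π hC).sub (M.measurable_V π' hC)) hε s a b
  rw [sub_sub_sub_comm, M.Q_sub_Q_eq π π' hC, M.Q_sub_Q_eq π π' hC, ← mul_sub, abs_mul,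
    abs_of_nonneg M.γ_nonneg, mul_assoc M.γ, mul_assoc M.γ]
  exact mul_le_mul_of_nonneg_left transition_bound M.γ_nonneg

end LipschitzInAction

namespace SmoothInAction

variable {M} (π : Kernel M.S (EuclideanSpace ℝ (Fin m))) [IsMarkovKernel π]

lemma differentiable_Q (hM : M.SmoothInAction) (s : M.S) : Differentiable ℝ (M.Q π s) := by
  obtain ⟨C, hC⟩ := hM.bounded_R
  rw [funext (M.Q_eq_reward_add_integral_V π hC s)]
  exact (hM.differentiable_R s).add
    ((hM.differentiable_transition _ _ (M.measurable_V π hC) (M.abs_V_le π hC) s).const_mul _)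

lemma differentiable_advantage (hM : M.SmoothInAction) (s : M.S) :
    Differentiable ℝ (M.advantage π s) :=
  (hM.differentiable_Q π s).sub_const _

end SmoothInAction

end ActionRegularity

section Regular

variable {d m : ℕ} {M : MDP d m}

lemma isFiniteMeasure_stateVolume (hS : volume M.S < ⊤) : IsFiniteMeasure (stateVolume M.S) := by
  refine ⟨?_⟩
  rw [stateVolume, comap_subtype_coe_apply M.measurableSet_S]
  simpa using hS

lemma integral_transition (x : M.S × EuclideanSpace ℝ (Fin m)) (f : M.S → ℝ) :
    ∫ s', f s' ∂(M.transition x) = ∫ s', M.T x.1 x.2 s' * f s' ∂(stateVolume M.S) := by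
  have measurable_density : Measurable (Function.uncurry
      fun (x : M.S × EuclideanSpace ℝ (Fin m)) (s' : M.S) =>
        ENNReal.ofReal (M.T x.1 x.2 s')) := M.measurable_T.ennreal_ofReal
  rw [transition, Kernel.withDensity_apply _ measurable_density, Kernel.const_apply,
    integral_withDensity_eq_integral_toReal_smul measurable_density.of_uncurry_left
      (ae_of_all _ fun _ => ENNReal.ofReal_lt_top)]
  simp only [ENNReal.toReal_ofReal (M.T_nonneg _ _ _), smul_eq_mul]

lemma integrable_T_mul {W : M.S → ℝ} (hW : Measurable W) {B : ℝ} (hB : ∀ s, |W s| ≤ B)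
    (s : M.S) (a : EuclideanSpace ℝ (Fin m)) :
    Integrable (fun s' => M.T s a s' * W s') (stateVolume M.S) := by
  have measurable_T : Measurable fun s' => M.T s a s' :=
    M.measurable_T.comp (measurable_prodMk_left (x := (s, a)))
  have integrable_T : Integrable (fun s' => M.T s a s') (stateVolume M.S) := by
    refine ⟨measurable_T.aestronglyMeasurable, ?_⟩
    rw [hasFiniteIntegral_iff_ofReal (ae_of_all _ fun s' => M.T_nonneg s a s'), M.lintegral_T]
    exact ENNReal.one_lt_top
  exact integrable_T.mul_bdd hW.aestronglyMeasurable (ae_of_all _ hB)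

namespace Regular

lemma exists_lipschitzWith_R (hM : M.Regular) : ∃ K, ∀ s, LipschitzWith K (M.R s) := by
  obtain ⟨K, hK⟩ := hM.bounded_grad_R
  refine ⟨K.toNNReal, fun s => lipschitzWith_of_nnnorm_fderiv_le (𝕜 := ℝ)
    (hM.differentiable_R s) fun a => ?_⟩
  rw [← norm_toNNReal, ← (InnerProductSpace.toDual ℝ _).symm.norm_map]
  exact Real.toNNReal_le_toNNReal (hK s a)

lemma exists_nnnorm_fderiv_T_le (hM : M.Regular) :
    ∃ K : NNReal, ∀ s a s', ‖fderiv ℝ (fun a => M.T s a s') a‖₊ ≤ K := by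
  obtain ⟨K, hK⟩ := hM.bounded_grad_T
  refine ⟨K.toNNReal, fun s a s' => ?_⟩
  rw [← norm_toNNReal, ← (InnerProductSpace.toDual ℝ _).symm.norm_map]
  exact Real.toNNReal_le_toNNReal (hK s a s')

lemma exists_lipschitz_transition (hM : M.Regular) (hS : volume M.S < ⊤) :
    ∃ K : ℝ, ∀ (W : M.S → ℝ) (B : ℝ), Measurable W → (∀ s, |W s| ≤ B) → ∀ s a b,
      |∫ s', W s' ∂(M.transition (s, a)) - ∫ s', W s' ∂(M.transition (s, b))| ≤
        K * B * dist a b := by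
  have := isFiniteMeasure_stateVolume hS
  obtain ⟨K, hK⟩ := hM.exists_nnnorm_fderiv_T_le
  refine ⟨K * (stateVolume M.S).real Set.univ, fun W B hW hB s a b => ?_⟩
  rw [integral_transition, integral_transition,
    ← integral_sub (integrable_T_mul hW hB s a) (integrable_T_mul hW hB s b)]
  have pointwise (s' : M.S) : ‖M.T s a s' * W s' - M.T s b s' * W s'‖ ≤ K * dist a b * B := by
    rw [← sub_mul, norm_mul, ← dist_eq_norm]
    exact mul_le_mul ((lipschitzWith_of_nnnorm_fderiv_le (𝕜 := ℝ) (hM.differentiable_T s s')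
      fun a => hK s a s').dist_le_mul a b) (hB s') (norm_nonneg _) (by positivity)
  exact (norm_integral_le_of_norm_le_const (ae_of_all _ pointwise)).trans_eq (by ring)

lemma differentiable_integral_transition (hM : M.Regular) (hS : volume M.S < ⊤) {W : M.S → ℝ}
    {B : ℝ} (hW : Measurable W) (hB : ∀ s, |W s| ≤ B) (s : M.S) :
    Differentiable ℝ fun a => ∫ s', W s' ∂(M.transition (s, a)) := by
  have := isFiniteMeasure_stateVolume hS
  obtain ⟨K, hK⟩ := hM.exists_nnnorm_fderiv_T_le
  simp_rw [integral_transition]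
  intro a
  have continuous_fderiv : Continuous fun s' => fderiv ℝ (fun a => M.T s a s') a := by
    have continuous_grad : Continuous fun s' => gradient (fun a => M.T s a s') a :=
      hM.continuous_grad_T.comp (by fun_prop : Continuous fun s' : M.S => (s, a, s'))
    simpa [gradient, Function.comp_def] using
      (InnerProductSpace.toDual ℝ (EuclideanSpace ℝ (Fin m))).continuous.comp continuous_grad
  refine (hasFDerivAt_integral_of_dominated_of_fderiv_le (𝕜 := ℝ) (s := Set.univ)
    (F := fun a s' => M.T s a s' * W s')
    (F' := fun a s' => W s' • fderiv ℝ (fun a => M.T s a s') a)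
    (bound := fun _ => B * K) univ_mem
    (Eventually.of_forall fun a => (integrable_T_mul hW hB s a).aestronglyMeasurable)
    (integrable_T_mul hW hB s a)
    (hW.aestronglyMeasurable.smul continuous_fderiv.aestronglyMeasurable)
    (ae_of_all _ fun s' x _ => ?_) (integrable_const _)
    (ae_of_all _ fun s' x _ =>
      (hM.differentiable_T s s' x).hasFDerivAt.mul_const (W s'))).differentiableAt
  rw [norm_smul]
  exact mul_le_mul (hB s') (hK s x s') (norm_nonneg _) ((abs_nonneg _).trans (hB s'))

theorem smoothInAction (hM : M.Regular) (hS : volume M.S < ⊤) : M.SmoothInAction where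
  bounded_R := hM.bounded_R
  lipschitz_R := hM.exists_lipschitzWith_R
  lipschitz_transition := hM.exists_lipschitz_transition hS
  differentiable_R := hM.differentiable_R
  differentiable_transition _ _ hW hB := hM.differentiable_integral_transition hS hW hB

end Regular

end Regular

end MDP

section StdGaussian

open scoped MatrixOrder in
lemma multivariateGaussian_sq_smul_one {ι : Type*} [Fintype ι] [DecidableEq ι]
    (v : EuclideanSpace ℝ ι) {σ : ℝ} (hσ : 0 ≤ σ) :
    multivariateGaussian v (σ ^ 2 • (1 : Matrix ι ι ℝ)) =
      (stdGaussian (EuclideanSpace ℝ ι)).map fun z => v + σ • z := by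
  have sqrt_eq : CFC.sqrt (σ ^ 2 • (1 : Matrix ι ι ℝ)) = σ • 1 := by
    refine CFC.sqrt_unique ?_ (Matrix.PosSemidef.one.smul hσ).nonneg
    rw [smul_mul_smul_comm, one_mul, pow_two]
  rw [multivariateGaussian, sqrt_eq]
  congr 1
  ext z : 1
  rw [map_smul, map_one]
  rfl

variable {E : Type*} [NormedAddCommGroup E] [InnerProductSpace ℝ E] [FiniteDimensional ℝ E]
  [MeasurableSpace E] [BorelSpace E]

lemma integrable_norm_stdGaussian : Integrable (fun z => ‖z‖) (stdGaussian E) :=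
  (IsGaussian.integrable_id (μ := stdGaussian E)).norm

lemma integrable_norm_sq_stdGaussian : Integrable (fun z => ‖z‖ ^ 2) (stdGaussian E) :=
  (memLp_two_iff_integrable_sq_norm (by fun_prop)).1
    (IsGaussian.memLp_two_id (μ := stdGaussian E))

lemma integrable_smul_self_stdGaussian {c : E → ℝ} (hc : Measurable c) {L : ℝ}
    (hL : ∀ z, |c z| ≤ L * ‖z‖) : Integrable (fun z => c z • z) (stdGaussian E) := by
  refine (integrable_norm_sq_stdGaussian.const_mul L).mono' (by fun_prop) (ae_of_all _ fun z => ?_)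
  rw [norm_smul, pow_two, ← mul_assoc]
  exact mul_le_mul_of_nonneg_right (hL z) (norm_nonneg z)

lemma abs_max_zero_le_abs (x : ℝ) : |max x 0| ≤ |x| := by
  rw [abs_of_nonneg (le_max_right x 0)]
  exact max_le (le_abs_self x) (abs_nonneg x)

lemma integrable_max_inner_smul_self_stdGaussian (b : E) :
    Integrable (fun z => max (inner ℝ b z) 0 • z) (stdGaussian E) :=
  integrable_smul_self_stdGaussian (by fun_prop) fun z =>
    (abs_max_zero_le_abs _).trans (abs_real_inner_le_norm b z)

lemma integral_comp_neg_stdGaussian {F : Type*} [NormedAddCommGroup F] [NormedSpace ℝ F]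
    (f : E → F) : ∫ z, f (-z) ∂(stdGaussian E) = ∫ z, f z ∂(stdGaussian E) := by
  conv_rhs => rw [← stdGaussian_map (LinearIsometryEquiv.neg ℝ (E := E))]
  exact ((LinearIsometryEquiv.neg ℝ (E := E)).toHomeomorph.measurableEmbedding.integral_map
    f).symm

lemma integral_inner_stdGaussian (b : E) : ∫ z, inner ℝ b z ∂(stdGaussian E) = 0 :=
  integral_strongDual_stdGaussian (innerSL ℝ b)

lemma integral_inner_mul_inner_stdGaussian (x y : E) :
    ∫ z, inner ℝ x z * inner ℝ y z ∂(stdGaussian E) = inner ℝ x y := by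
  have covariance_eq := covarianceBilin_apply_eq_cov
    (IsGaussian.memLp_two_id (μ := stdGaussian E)) x y
  rw [covarianceBilin_stdGaussian, covariance, integral_inner_stdGaussian,
    integral_inner_stdGaussian] at covariance_eq
  simp only [sub_zero] at covariance_eq
  exact covariance_eq.symm

lemma integral_inner_smul_self_stdGaussian (b : E) :
    ∫ z, inner ℝ b z • z ∂(stdGaussian E) = b := by
  have integrable : Integrable (fun z => inner ℝ b z • z) (stdGaussian E) :=
    integrable_smul_self_stdGaussian (by fun_prop) fun z => abs_real_inner_le_norm b z
  refine ext_inner_left ℝ fun x => ?_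
  rw [← integral_inner integrable x, ← integral_inner_mul_inner_stdGaussian x b]
  simp only [real_inner_smul_right, mul_comm]

lemma integral_max_inner_smul_self_stdGaussian (b : E) :
    ∫ z, max (inner ℝ b z) 0 • z ∂(stdGaussian E) = (1 / 2 : ℝ) • b := by
  have reflected : ∫ z, max (inner ℝ (-b) z) 0 • z ∂(stdGaussian E) =
      -∫ z, max (inner ℝ b z) 0 • z ∂(stdGaussian E) := by
    rw [← integral_comp_neg_stdGaussian fun z => max (inner ℝ b z) 0 • z, ← integral_neg]
    simp only [inner_neg_left, inner_neg_right, smul_neg, neg_neg]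
  have sub_reflected : ∫ z, max (inner ℝ b z) 0 • z ∂(stdGaussian E) -
      ∫ z, max (inner ℝ (-b) z) 0 • z ∂(stdGaussian E) = b := by
    rw [← integral_sub (integrable_max_inner_smul_self_stdGaussian b)
      (integrable_max_inner_smul_self_stdGaussian (-b))]
    simp only [inner_neg_left, ← sub_smul, max_zero_sub_max_neg_zero_eq_self,
      integral_inner_smul_self_stdGaussian]
  rw [reflected, sub_neg_eq_add, ← two_smul ℝ] at sub_reflected
  nth_rewrite 2 [← sub_reflected]
  rw [smul_smul]
  norm_num

variable {F ι : Type*} [NormedAddCommGroup F] [NormedSpace ℝ F] [CompleteSpace F]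
  {l : Filter ι} [l.IsCountablyGenerated] {q : ι → E → ℝ} {L : ℝ} {b : E}

lemma tendsto_integral_max_smul_stdGaussian (hq : ∀ i, Measurable (q i))
    (hL : ∀ᶠ i in l, ∀ z, |q i z| ≤ L * (1 + ‖z‖))
    (hlim : ∀ z, Tendsto (q · z) l (𝓝 (inner ℝ b z))) (Λ : E →L[ℝ] F) :
    Tendsto (fun i => ∫ z, max (q i z) 0 • Λ z ∂(stdGaussian E)) l (𝓝 ((1 / 2 : ℝ) • Λ b)) := by
  have limit_eq : ∫ z, max (inner ℝ b z) 0 • Λ z ∂(stdGaussian E) = (1 / 2 : ℝ) • Λ b := by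
    simp_rw [← map_smul]
    rw [Λ.integral_comp_comm (integrable_max_inner_smul_self_stdGaussian b),
      integral_max_inner_smul_self_stdGaussian]
  rw [← limit_eq]
  refine tendsto_integral_filter_of_dominated_convergence
    (fun z => L * ‖Λ‖ * ‖z‖ + L * ‖Λ‖ * ‖z‖ ^ 2) ?_ ?_
    ((integrable_norm_stdGaussian.const_mul _).add (integrable_norm_sq_stdGaussian.const_mul _))
    (ae_of_all _ fun z => ((hlim z).max tendsto_const_nhds).smul_const _)
  · exact Eventually.of_forall fun i => ((hq i).max measurable_const).aestronglyMeasurable.smul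
      Λ.continuous.aestronglyMeasurable
  · filter_upwards [hL] with i hi
    refine ae_of_all _ fun z => ?_
    calc ‖max (q i z) 0 • Λ z‖ = |max (q i z) 0| * ‖Λ z‖ := norm_smul _ _
      _ ≤ (L * (1 + ‖z‖)) * (‖Λ‖ * ‖z‖) :=
          mul_le_mul ((abs_max_zero_le_abs _).trans (hi z)) (Λ.le_opNorm z) (norm_nonneg _)
            ((abs_nonneg _).trans (hi z))
      _ = L * ‖Λ‖ * ‖z‖ + L * ‖Λ‖ * ‖z‖ ^ 2 := by ring

lemma tendsto_integral_stdGaussian_of_tendsto_inner (hq : ∀ i, Measurable (q i))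
    (hL : ∀ᶠ i in l, ∀ z, |q i z| ≤ L * ‖z‖)
    (hlim : ∀ z, Tendsto (q · z) l (𝓝 (inner ℝ b z))) :
    Tendsto (fun i => ∫ z, q i z ∂(stdGaussian E)) l (𝓝 0) := by
  rw [← integral_inner_stdGaussian b]
  exact tendsto_integral_filter_of_dominated_convergence _
    (Eventually.of_forall fun i => (hq i).aestronglyMeasurable)
    (hL.mono fun i hi => ae_of_all _ hi) (integrable_norm_stdGaussian.const_mul L)
    (ae_of_all _ hlim)

lemma abs_integral_stdGaussian_le {f : E → ℝ} (hL : ∀ z, |f z| ≤ L * ‖z‖) :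
    |∫ z, f z ∂(stdGaussian E)| ≤ L * ∫ z, ‖z‖ ∂(stdGaussian E) := by
  rw [← integral_const_mul]
  exact norm_integral_le_of_norm_le (f := f) (integrable_norm_stdGaussian.const_mul L)
    (ae_of_all _ hL)

lemma tendsto_integral_max_sub_integral_smul_stdGaussian (hL₀ : 0 ≤ L)
    (hq : ∀ i, Measurable (q i)) (hL : ∀ᶠ i in l, ∀ z, |q i z| ≤ L * ‖z‖)
    (hlim : ∀ z, Tendsto (q · z) l (𝓝 (inner ℝ b z))) (Λ : E →L[ℝ] F) :
    Tendsto (fun i => ∫ z, max (q i z - ∫ z', q i z' ∂(stdGaussian E)) 0 • Λ z ∂(stdGaussian E)) l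
      (𝓝 ((1 / 2 : ℝ) • Λ b)) := by
  set m := ∫ z, ‖z‖ ∂(stdGaussian E)
  have m_nonneg : 0 ≤ m := integral_nonneg fun _ => norm_nonneg _
  refine tendsto_integral_max_smul_stdGaussian (L := L * (1 + m))
    (fun i => (hq i).sub_const _) ?_ (fun z => ?_) Λ
  · filter_upwards [hL] with i hi z
    calc |q i z - ∫ z', q i z' ∂(stdGaussian E)|
        ≤ L * ‖z‖ + L * m :=
          (abs_sub _ _).trans (add_le_add (hi z) (abs_integral_stdGaussian_le hi))
      _ ≤ L * ‖z‖ + L * m + (L + L * (m * ‖z‖)) := le_add_of_nonneg_right <|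
          add_nonneg hL₀ (mul_nonneg hL₀ (mul_nonneg m_nonneg (norm_nonneg z)))
      _ = L * (1 + m) * (1 + ‖z‖) := by ring
  · simpa only [sub_zero] using
      (hlim z).sub (tendsto_integral_stdGaussian_of_tendsto_inner hq hL hlim)

end StdGaussian

namespace MDP

variable {d m n : ℕ} {M : MDP d m}

namespace ParamPolicy

variable (μ : M.ParamPolicy n) (θ : EuclideanSpace ℝ (Fin n))

section Values

variable {σ : ℝ}

lemma gaussian_apply (hσ : 0 ≤ σ) (s : M.S) :
    μ.gaussian θ σ s =
      (stdGaussian (EuclideanSpace ℝ (Fin m))).map fun z => μ.act θ s + σ • z :=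
  multivariateGaussian_sq_smul_one _ hσ

lemma integral_gaussian {F : Type*} [NormedAddCommGroup F] [NormedSpace ℝ F] (hσ : 0 ≤ σ)
    (s : M.S) {f : EuclideanSpace ℝ (Fin m) → F} (hf : StronglyMeasurable f) :
    ∫ a, f a ∂(μ.gaussian θ σ s) =
      ∫ z, f (μ.act θ s + σ • z) ∂(stdGaussian (EuclideanSpace ℝ (Fin m))) := by
  rw [μ.gaussian_apply θ hσ, integral_map (by fun_prop) hf.aestronglyMeasurable]

lemma integrable_id_gaussian (s : M.S) : Integrable (fun a => a) (μ.gaussian θ σ s) :=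
  IsGaussian.integrable_id
    (μ := multivariateGaussian (μ.act θ s) (σ ^ 2 • (1 : Matrix (Fin m) (Fin m) ℝ)))

lemma integral_det {f : EuclideanSpace ℝ (Fin m) → ℝ} (hf : Measurable f) (s : M.S) :
    ∫ a, f a ∂(μ.det θ s) = f (μ.act θ s) :=
  integral_dirac' f _ hf.stronglyMeasurable

end Values

/-- The difference quotient `σ⁻¹ (Q^π(s, μ_θ(s) + σ z) - Q^π(s, μ_θ(s)))` of the action-value
function of the exploration policy `π = π_{θ,σ}` in the direction `z`, with `σ` both the step size
and the standard deviation of the policy. -/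
noncomputable def explorationQuotient (s : M.S) (σ : ℝ) (z : EuclideanSpace ℝ (Fin m)) : ℝ :=
  σ⁻¹ * (M.Q (μ.gaussian θ σ) s (μ.act θ s + σ • z) - M.Q (μ.gaussian θ σ) s (μ.act θ s))

section ExplorationQuotient

variable {C σ : ℝ}

lemma measurable_explorationQuotient (hC : ∀ s a, |M.R s a| ≤ C) (s : M.S) :
    Measurable (μ.explorationQuotient θ s σ) :=
  (((M.measurable_Q _ hC s).comp (by fun_prop)).sub_const _).const_mul _

lemma integral_explorationQuotient (hC : ∀ s a, |M.R s a| ≤ C) (hσ : 0 ≤ σ) (s : M.S) :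
    ∫ z, μ.explorationQuotient θ s σ z ∂(stdGaussian (EuclideanSpace ℝ (Fin m))) =
      σ⁻¹ * (M.V (μ.gaussian θ σ) s - M.Q (μ.gaussian θ σ) s (μ.act θ s)) := by
  have measurable_Q := M.measurable_Q (μ.gaussian θ σ) hC s
  rw [M.V_eq_integral_Q _ hC, μ.integral_gaussian θ hσ s measurable_Q.stronglyMeasurable]
  simp only [explorationQuotient]
  rw [integral_const_mul, integral_sub ?_ (integrable_const _), integral_const, probReal_univ,
    one_smul]
  exact integrable_of_forall_abs_le (measurable_Q.comp (by fun_prop))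
    fun z => M.abs_Q_le _ hC s _

lemma inv_mul_advantage_eq (hC : ∀ s a, |M.R s a| ≤ C) (hσ : 0 ≤ σ) (s : M.S)
    (z : EuclideanSpace ℝ (Fin m)) :
    σ⁻¹ * M.advantage (μ.gaussian θ σ) s (μ.act θ s + σ • z) =
      μ.explorationQuotient θ s σ z -
        ∫ z', μ.explorationQuotient θ s σ z' ∂(stdGaussian (EuclideanSpace ℝ (Fin m))) := by
  rw [μ.integral_explorationQuotient θ hC hσ, explorationQuotient, advantage]
  ring

lemma abs_explorationQuotient_le {L : NNReal} {s : M.S}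
    (hL : LipschitzWith L (M.Q (μ.gaussian θ σ) s)) (hσ : 0 < σ)
    (z : EuclideanSpace ℝ (Fin m)) : |μ.explorationQuotient θ s σ z| ≤ L * ‖z‖ := by
  rw [explorationQuotient, abs_mul, abs_of_pos (inv_pos.2 hσ), inv_mul_le_iff₀ hσ]
  calc |M.Q (μ.gaussian θ σ) s (μ.act θ s + σ • z) - M.Q (μ.gaussian θ σ) s (μ.act θ s)|
      ≤ L * dist (μ.act θ s + σ • z) (μ.act θ s) := hL.dist_le_mul _ _
    _ = σ * (L * ‖z‖) := by
      rw [dist_self_add_left, norm_smul, Real.norm_of_nonneg hσ.le]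
      ring

lemma abs_V_gaussian_sub_Q_le (hC : ∀ s a, |M.R s a| ≤ C) {L : NNReal} {s : M.S}
    (hL : LipschitzWith L (M.Q (μ.gaussian θ σ) s)) (hσ : 0 < σ) :
    |M.V (μ.gaussian θ σ) s - M.Q (μ.gaussian θ σ) s (μ.act θ s)| ≤
      L * (∫ z, ‖z‖ ∂(stdGaussian (EuclideanSpace ℝ (Fin m)))) * σ := by
  have integral_le := abs_integral_stdGaussian_le (μ.abs_explorationQuotient_le θ hL hσ)
  rw [μ.integral_explorationQuotient θ hC hσ.le, abs_mul, abs_of_pos (inv_pos.2 hσ),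
    inv_mul_le_iff₀ hσ] at integral_le
  exact integral_le.trans_eq (mul_comm _ _)

theorem exists_abs_V_gaussian_sub_V_det_le (hM : M.LipschitzInAction) :
    ∃ K, ∀ σ, 0 < σ → ∀ s, |M.V (μ.gaussian θ σ) s - M.V (μ.det θ) s| ≤ K * σ := by
  obtain ⟨C, hC⟩ := hM.bounded_R
  obtain ⟨L, hL⟩ := hM.exists_lipschitzWith_Q
  refine ⟨L * (∫ z, ‖z‖ ∂(stdGaussian (EuclideanSpace ℝ (Fin m)))) / (1 - M.γ),
    fun σ hσ s => ?_⟩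
  rw [div_mul_eq_mul_div]
  refine M.abs_V_sub_V_le_of_abs_V_sub_integral_Q_le _ _ hC (fun s => ?_) s
  rw [μ.integral_det θ (M.measurable_Q _ hC s)]
  exact μ.abs_V_gaussian_sub_Q_le θ hC (hL _ s) hσ

theorem tendsto_explorationQuotient (hM : M.SmoothInAction) (s : M.S)
    (z : EuclideanSpace ℝ (Fin m)) :
    Tendsto (fun σ => μ.explorationQuotient θ s σ z) (𝓝[>] 0)
      (𝓝 (inner ℝ (gradient (M.advantage (μ.det θ) s) (μ.act θ s)) z)) := by
  obtain ⟨K, hK⟩ := hM.exists_abs_Q_increment_sub_le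
  obtain ⟨K', hK'⟩ := μ.exists_abs_V_gaussian_sub_V_det_le θ hM.toLipschitzInAction
  let detQuotient (σ : ℝ) : ℝ :=
    σ⁻¹ * (M.Q (μ.det θ) s (μ.act θ s + σ • z) - M.Q (μ.det θ) s (μ.act θ s))
  have tendsto_detQuotient : Tendsto detQuotient (𝓝[>] 0)
      (𝓝 (inner ℝ (gradient (M.advantage (μ.det θ) s) (μ.act θ s)) z)) := by
    rw [M.inner_gradient_advantage]
    exact ((hM.differentiable_Q (μ.det θ) s _).hasFDerivAt.hasLineDerivAt z)
      |>.tendsto_slope_zero_right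
  have sub_detQuotient_le : ∀ᶠ σ in 𝓝[>] 0,
      ‖μ.explorationQuotient θ s σ z - detQuotient σ‖ ≤ K * (K' * σ) * ‖z‖ := by
    filter_upwards [self_mem_nhdsWithin] with σ (hσ : 0 < σ)
    rw [explorationQuotient, ← mul_sub, norm_mul, Real.norm_of_nonneg (inv_nonneg.2 hσ.le),
      inv_mul_le_iff₀ hσ, Real.norm_eq_abs]
    refine (hK _ _ _ (hK' σ hσ) s _ _).trans_eq ?_
    rw [dist_self_add_left, norm_smul, Real.norm_of_nonneg hσ.le]
    ring
  have tendsto_bound : Tendsto (fun σ => K * (K' * σ) * ‖z‖) (𝓝[>] 0) (𝓝 0) := by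
    have continuous_bound : Continuous fun σ => K * (K' * σ) * ‖z‖ := by fun_prop
    simpa using (continuous_bound.tendsto 0).mono_left nhdsWithin_le_nhds
  simpa only [sub_add_cancel, zero_add] using
    (squeeze_zero_norm' sub_detQuotient_le tendsto_bound).add tendsto_detQuotient

end ExplorationQuotient

end ParamPolicy

section CAC

lemma mul_heaviside (x : ℝ) : x * heaviside x = max x 0 := by
  unfold heaviside
  split_ifs with h
  · rw [mul_one, max_eq_left h.le]
  · rw [mul_zero, max_eq_right (not_lt.1 h)]

/-- Multiplication of row vectors by a matrix, as a continuous linear map out of the Euclidean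
space. -/
noncomputable def vecMulCLM (J : Matrix (Fin m) (Fin n) ℝ) :
    EuclideanSpace ℝ (Fin m) →L[ℝ] (Fin n → ℝ) :=
  LinearMap.toContinuousLinearMap
    (J.vecMulLinear ∘ₗ (WithLp.linearEquiv 2 ℝ (Fin m → ℝ)).toLinearMap)

lemma vecMulCLM_apply (J : Matrix (Fin m) (Fin n) ℝ) (x : EuclideanSpace ℝ (Fin m)) :
    vecMulCLM J x = Matrix.vecMul x.ofLp J := rfl

namespace ParamPolicy

variable (μ : M.ParamPolicy n) (θ : EuclideanSpace ℝ (Fin n)) {C σ : ℝ}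

lemma cacIntegrand_eq (s : M.S) : μ.cacIntegrand θ σ s = fun a =>
    max (M.advantage (μ.gaussian θ σ) s a) 0 • vecMulCLM (μ.jacobian θ s) (μ.act θ s - a) := by
  funext a
  rw [cacIntegrand, mul_heaviside, vecMulCLM_apply]

lemma measurable_max_advantage (hC : ∀ s a, |M.R s a| ≤ C) (s : M.S) :
    Measurable fun a => max (M.advantage (μ.gaussian θ σ) s a) 0 :=
  ((M.measurable_Q _ hC s).sub_const _).max measurable_const

lemma measurable_cacIntegrand (hC : ∀ s a, |M.R s a| ≤ C) (s : M.S) :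
    Measurable (μ.cacIntegrand θ σ s) := by
  have measurable_max := μ.measurable_max_advantage θ (σ := σ) hC s
  rw [cacIntegrand_eq]
  fun_prop

theorem integrable_cacIntegrand (hC : ∀ s a, |M.R s a| ≤ C) (s : M.S) :
    Integrable (μ.cacIntegrand θ σ s) (μ.gaussian θ σ s) := by
  rw [cacIntegrand_eq]
  refine ((vecMulCLM (μ.jacobian θ s)).integrable_comp ((integrable_const (μ.act θ s)).sub
    (μ.integrable_id_gaussian θ s))).bdd_smul (C / (1 - M.γ) + C / (1 - M.γ))
    (μ.measurable_max_advantage θ hC s).aestronglyMeasurable (ae_of_all _ fun a => ?_)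
  exact (abs_max_zero_le_abs _).trans
    ((abs_sub _ _).trans (add_le_add (M.abs_Q_le _ hC s a) (M.abs_V_le _ hC s)))

lemma neg_inv_sq_smul_cac_eq (hC : ∀ s a, |M.R s a| ≤ C) (hσ : 0 < σ) (s : M.S) :
    -(1 / σ ^ 2) • μ.cac θ σ s =
      ∫ z, max (σ⁻¹ * M.advantage (μ.gaussian θ σ) s (μ.act θ s + σ • z)) 0 •
        vecMulCLM (μ.jacobian θ s) z ∂(stdGaussian (EuclideanSpace ℝ (Fin m))) := by
  rw [cac, μ.integral_gaussian θ hσ.le s (μ.measurable_cacIntegrand θ hC s).stronglyMeasurable,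
    ← integral_smul]
  congr 1 with z : 1
  have max_inv_mul (x : ℝ) : max (σ⁻¹ * x) 0 = σ⁻¹ * max x 0 := by
    rw [mul_max_of_nonneg _ _ (inv_nonneg.2 hσ.le), mul_zero]
  simp only [cacIntegrand_eq, sub_add_cancel_left, map_smul, max_inv_mul, ← neg_smul,
    smul_smul]
  congr 1
  field_simp

theorem tendsto_neg_inv_sq_smul_cac (hM : M.SmoothInAction) (s : M.S) :
    Tendsto (fun σ : ℝ => -(1 / σ ^ 2) • μ.cac θ σ s) (𝓝[>] 0)
      (𝓝 ((1 / 2 : ℝ) • μ.dpg θ s)) := by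
  obtain ⟨C, hC⟩ := hM.bounded_R
  obtain ⟨L, hL⟩ := hM.exists_lipschitzWith_Q
  have abs_quotient_le : ∀ᶠ σ in 𝓝[>] 0, ∀ z, |μ.explorationQuotient θ s σ z| ≤ L * ‖z‖ :=
    eventually_nhdsWithin_of_forall fun σ hσ => μ.abs_explorationQuotient_le θ (hL _ s) hσ
  refine (tendsto_integral_max_sub_integral_smul_stdGaussian L.coe_nonneg
    (fun σ => μ.measurable_explorationQuotient θ hC s) abs_quotient_le
    (μ.tendsto_explorationQuotient θ hM s) (vecMulCLM (μ.jacobian θ s))).congr' ?_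
  filter_upwards [self_mem_nhdsWithin] with σ (hσ : 0 < σ)
  simp only [μ.neg_inv_sq_smul_cac_eq θ hC hσ, μ.inv_mul_advantage_eq θ hC hσ.le]

end ParamPolicy

end CAC

end MDP

theorem mainTheorem1_general {d m n : ℕ} (M : MDP d m) (hM : M.SmoothInAction)
    (μ : M.ParamPolicy n) (θ : EuclideanSpace ℝ (Fin n)) (s : M.S)
    (_hμ : DifferentiableAt ℝ (fun ϑ => μ.act ϑ s) θ) :
    DifferentiableAt ℝ (M.advantage (μ.det θ) s) (μ.act θ s) ∧
    (∀ σ : ℝ, 0 < σ → Integrable (μ.cacIntegrand θ σ s) (μ.gaussian θ σ s)) ∧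
    Tendsto (fun σ : ℝ => -(1 / σ ^ 2) • μ.cac θ σ s) (𝓝[>] 0)
      (𝓝 ((1 / 2 : ℝ) • μ.dpg θ s)) := by
  obtain ⟨C, hC⟩ := hM.bounded_R
  exact ⟨hM.differentiable_advantage (μ.det θ) s _,
    fun σ _ => μ.integrable_cacIntegrand θ hC s, μ.tendsto_neg_inv_sq_smul_cac θ hM s⟩

theorem mainTheorem1 {d m n : ℕ} (M : MDP d m) (hM : M.Regular) (hS : volume M.S < ⊤)
    (μ : M.ParamPolicy n) (hμ : μ.Regular) (θ : EuclideanSpace ℝ (Fin n)) (s : M.S) :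
    DifferentiableAt ℝ (M.advantage (μ.det θ) s) (μ.act θ s) ∧
    (∀ σ : ℝ, 0 < σ → Integrable (μ.cacIntegrand θ σ s) (μ.gaussian θ σ s)) ∧
    ∃ g : Fin n → ℝ, (∀ k, 0 < g k ∧ g k ≤ 1) ∧
      Tendsto (fun σ : ℝ => -(1 / σ ^ 2) • μ.cac θ σ s) (𝓝[>] 0) (𝓝 (g * μ.dpg θ s)) := by
  obtain ⟨differentiableAt, integrable, tendsto⟩ :=
    mainTheorem1_general M (hM.smoothInAction hS) μ θ s (hμ.differentiable_act s θ)
  exact ⟨differentiableAt, integrable, fun _ => 1 / 2, fun _ => by norm_num, tendsto⟩
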